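/- A complex unit gain graph $\Phi=(G,\varphi)$ is a finite simple graph $G$ together with a map $\varphi$ assigning to each oriented edge $(u,v)$ of $G$ a complex number of modulus $1$, with $\varphi(v,u)=\varphi(u,v)^{-1}$. Its adjacency matrix $A(\Phi)$ is the Hermitian matrix with entries $\varphi(u,v)$ for $u\sim v$ and $0$ otherwise, and its energy $E(\Phi)$ is the sum of the absolute values of the eigenvalues of $A(\Phi)$, counted with multiplicity. The gain of an oriented cycle is the product of the gains of its oriented edges. For integers $r,s\ge 3$ and $\ell\ge 1$, the dumbbell graph $D_{r,s,\ell}$ consists of two vertex-disjoint cycles $C_r$ and $C_s$ (of lengths $r$ and $s$), with one vertex of $C_r$ joined to one vertex of $C_s$ by a path of length $\ell$. **Theorem.** Let $r,s\ge 3$ and $\ell\ge 1$ be integers with $r$ and $s$ even. For a complex unit gain graph $\Phi$ on $D_{r,s,\ell}$, let $\gamma_r$ and $\gamma_s$ be the gains of $C_r$ and $C_s$ (each traversed in a fixed direction), and put $\alpha=(-1)^{r/2}\operatorname{Re}\gamma_r$ and $\beta=(-1)^{s/2}\operatorname{Re}\gamma_s$. Among all complex unit gain graphs $\Phi$ on $D_{r,s,\ell}$,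 the minimum of $E(\Phi)$ is attained, exactly by those $\Phi$ with $(\alpha,\beta)=(1,1)$, and the maximum of $E(\Phi)$ is attained, exactly by those $\Phi$ with $(\alpha,\beta)=(-1,-1)$. **Corollary.** Under the same assumptions: (a) if $r\equiv s\equiv 0\pmod 4$, the minimum is attained exactly at $(\gamma_r,\gamma_s)=(1,1)$ and the maximum exactly at $(-1,-1)$; (b) if $r\equiv s\equiv 2\pmod 4$, the minimum is attained exactly at $(\gamma_r,\gamma_s)=(-1,-1)$ and the maximum exactly at $(1,1)$; (c) if $r\equiv 0$ and $s\equiv 2\pmod 4$, the minimum is attained exactly at $(\gamma_r,\gamma_s)=(1,-1)$ and the maximum exactly at $(-1,1)$; (d) if $r\equiv 2$ and $s\equiv 0\pmod 4$, the minimum is attained exactly at $(\gamma_r,\gamma_s)=(-1,1)$ and the maximum exactly at $(1,-1)$. -/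

import Mathlib

/-- A complex unit gain graph with underlying simple graph `G`: each oriented edge (dart) carries a
unit complex number, and reversing the orientation inverts the gain. -/
structure UnitGainGraph {V : Type*} (G : SimpleGraph V) where
  gain : G.Dart → Circle
  gain_symm : ∀ d : G.Dart, gain d.symm = (gain d)⁻¹

namespace UnitGainGraph

variable {V : Type*} {G : SimpleGraph V}

open Classical in
/-- The Hermitian adjacency matrix: the gain of `(u, v)` if `u` and `v` are adjacent, else `0`. -/
noncomputable def adjMatrix (Φ : UnitGainGraph G) : Matrix V V ℂ :=
  fun u v => if h : G.Adj u v then (Φ.gain ⟨(u, v), h⟩ : ℂ) else 0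

theorem adjMatrix_isHermitian (Φ : UnitGainGraph G) : Φ.adjMatrix.IsHermitian := by
  ext u v
  rw [Matrix.conjTranspose_apply]
  unfold adjMatrix
  by_cases h : G.Adj u v
  · have h2 := Φ.gain_symm ⟨(u, v), h⟩
    rw [dif_pos h, dif_pos h.symm]
    change star ((Φ.gain (SimpleGraph.Dart.symm ⟨(u, v), h⟩) : Circle) : ℂ) = _
    rw [h2, Circle.coe_inv_eq_conj]
    simp
  · rw [dif_neg h, dif_neg (fun h' => h h'.symm)]
    simp

/-- The energy: the sum of the absolute values of the eigenvalues of the adjacency matrix,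
counted with multiplicity. -/
noncomputable def energy [Fintype V] [DecidableEq V] (Φ : UnitGainGraph G) : ℝ :=
  ∑ j, |Φ.adjMatrix_isHermitian.eigenvalues j|

end UnitGainGraph

theorem cycleGraph_adj_finRotate {n : ℕ} (hn : 3 ≤ n) (i : Fin n) :
    (SimpleGraph.cycleGraph n).Adj i (finRotate n i) := by
  obtain ⟨m, rfl⟩ : ∃ m, n = m + 2 := ⟨n - 2, by omega⟩
  rw [SimpleGraph.cycleGraph_adj, finRotate_apply]
  right
  simp

/-- The gain of the cycle `c 0, c 1, …, c (n - 1), c 0`, the image of the `n`-cycle under `c`: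
the product of the gains of the oriented edges `(c i, c (i + 1))`, indices mod `n`. -/
noncomputable def UnitGainGraph.cycleGain {V : Type*} {G : SimpleGraph V} (Φ : UnitGainGraph G)
    {n : ℕ} (hn : 3 ≤ n) (c : SimpleGraph.cycleGraph n →g G) : Circle :=
  ∏ i : Fin n,
    Φ.gain ⟨(c i, c (finRotate n i)), c.map_adj (cycleGraph_adj_finRotate hn i)⟩

/-- The edges attaching the `ℓ - 1` inner vertices of the joining path (the last summand) to vertex
`0` of the first cycle and to vertex `0` of the second; if `ℓ = 1` there is no inner vertex, and the
path is the single edge between these two vertices. -/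
def dumbbellLink (r s ℓ : ℕ) :
    (Fin r ⊕ Fin s) ⊕ Fin (ℓ - 1) → (Fin r ⊕ Fin s) ⊕ Fin (ℓ - 1) → Prop
  | .inl (.inl i), .inr p => i.val = 0 ∧ p.val = 0
  | .inr p, .inl (.inr j) => p.val + 2 = ℓ ∧ j.val = 0
  | .inl (.inl i), .inl (.inr j) => ℓ = 1 ∧ i.val = 0 ∧ j.val = 0
  | _, _ => False

/-- The dumbbell graph `D_{r,s,ℓ}` (for `3 ≤ r`, `3 ≤ s`, `1 ≤ ℓ`): two disjoint cycles of lengths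
`r` and `s`, a vertex of the one joined to a vertex of the other by a path of length `ℓ`. -/
def dumbbellGraph (r s ℓ : ℕ) : SimpleGraph ((Fin r ⊕ Fin s) ⊕ Fin (ℓ - 1)) :=
  SimpleGraph.sum (SimpleGraph.sum (SimpleGraph.cycleGraph r) (SimpleGraph.cycleGraph s))
      (SimpleGraph.pathGraph (ℓ - 1)) ⊔
    SimpleGraph.fromRel (dumbbellLink r s ℓ)

/-- The cycle `C_r` of the dumbbell graph. -/
def dumbbellCycleLeft (r s ℓ : ℕ) : SimpleGraph.cycleGraph r →g dumbbellGraph r s ℓ where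
  toFun i := .inl (.inl i)
  map_rel' h := Or.inl h

/-- The cycle `C_s` of the dumbbell graph. -/
def dumbbellCycleRight (r s ℓ : ℕ) : SimpleGraph.cycleGraph s →g dumbbellGraph r s ℓ where
  toFun j := .inl (.inr j)
  map_rel' h := Or.inl h

/-- The gain `γ_r` of the cycle `C_r` in a gain graph on `D_{r,s,ℓ}`. -/
noncomputable def gammaLeft {r s ℓ : ℕ} (hr : 3 ≤ r) (Φ : UnitGainGraph (dumbbellGraph r s ℓ)) :
    ℂ :=
  (Φ.cycleGain hr (dumbbellCycleLeft r s ℓ) : ℂ)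

/-- The gain `γ_s` of the cycle `C_s` in a gain graph on `D_{r,s,ℓ}`. -/
noncomputable def gammaRight {r s ℓ : ℕ} (hs : 3 ≤ s) (Φ : UnitGainGraph (dumbbellGraph r s ℓ)) :
    ℂ :=
  (Φ.cycleGain hs (dumbbellCycleRight r s ℓ) : ℂ)

/-- `α = (-1)^{r/2} Re γ_r`, for even `r`. -/
noncomputable def alphaParam {r s ℓ : ℕ} (hr : 3 ≤ r) (Φ : UnitGainGraph (dumbbellGraph r s ℓ)) :
    ℝ :=
  (-1) ^ (r / 2) * (gammaLeft hr Φ).re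

/-- `β = (-1)^{s/2} Re γ_s`, for even `s`. -/
noncomputable def betaParam {r s ℓ : ℕ} (hs : 3 ≤ s) (Φ : UnitGainGraph (dumbbellGraph r s ℓ)) :
    ℝ :=
  (-1) ^ (s / 2) * (gammaRight hs Φ).re

/-- `Φ` has minimum energy among all complex unit gain graphs with the same underlying graph. -/
def IsMinEnergy {V : Type*} [Fintype V] [DecidableEq V] {G : SimpleGraph V}
    (Φ : UnitGainGraph G) : Prop :=
  ∀ Ψ : UnitGainGraph G, Φ.energy ≤ Ψ.energy

/-- `Φ` has maximum energy among all complex unit gain graphs with the same underlying graph. -/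
def IsMaxEnergy {V : Type*} [Fintype V] [DecidableEq V] {G : SimpleGraph V}
    (Φ : UnitGainGraph G) : Prop :=
  ∀ Ψ : UnitGainGraph G, Ψ.energy ≤ Φ.energy

/-!
Coulson's integral: `∫₀^∞ log (1 + (a / t)²) dt` is a positive constant times `|a|`. Hence the
energy `∑ |λ_j|` increases whenever `∏ (t² + λ_j²) = |det (t + i A)|²` does for all `t > 0`, and it
suffices to compare these determinants.

Deleting the base vertex of either cycle leaves a path, on which `t + i A` is tridiagonal with
opposite off-diagonal entries of product `i γ · i γ⁻¹ = -1`; its determinant is a continuant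
`K_n = t K_{n-1} + K_{n-2}`, which does not depend on the gains. Taking the Schur complement onto
the joining path turns a cycle of even length `n` and parameter `α` into the load
`(2 K_{n-2} - 2 α) / K_{n-1} ≥ 0` added to one end of the diagonal `(t, …, t)`. A continuant is
strictly increasing in the diagonal and the loads strictly decrease in `α` and `β`, so the energy is
strictly decreasing in `(α, β)`, which takes every value in the square `[-1, 1]²`.
-/

section Coulson

open MeasureTheory Set

theorem setIntegral_pos_of_pos {X : Type*} [MeasurableSpace X] {μ : Measure X} {s : Set X}
    (hs : MeasurableSet s) (hμ : μ s ≠ 0) {f : X → ℝ} (hf : IntegrableOn f s μ)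
    (hpos : ∀ x ∈ s, 0 < f x) : 0 < ∫ x in s, f x ∂μ := by
  have hnonneg : 0 ≤ᵐ[μ.restrict s] f :=
    (ae_restrict_iff' hs).2 (.of_forall fun x hx => (hpos x hx).le)
  rw [setIntegral_pos_iff_support_of_nonneg_ae hnonneg hf,
    inter_eq_right.2 fun x hx => Function.mem_support.2 (hpos x hx).ne']
  exact pos_iff_ne_zero.2 hμ

theorem integrableOn_Ioc_log_one_add_inv_sq (b : ℝ) :
    IntegrableOn (fun t : ℝ => Real.log (1 + t⁻¹ ^ 2)) (Ioc 0 b) := by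
  rcases le_total b 0 with hb | hb
  · simp [Ioc_eq_empty_of_le hb]
  have hdiff : IntegrableOn (fun t : ℝ => Real.log (1 + t ^ 2) - 2 * Real.log t) (Ioc 0 b) := by
    rw [← intervalIntegrable_iff_integrableOn_Ioc_of_le hb]
    refine IntervalIntegrable.sub (Continuous.intervalIntegrable ?_ _ _)
      (intervalIntegral.intervalIntegrable_log'.const_mul 2)
    exact Continuous.log (by fun_prop) fun t => by positivity
  refine hdiff.congr_fun (fun t (ht : t ∈ Ioc 0 b) => ?_) measurableSet_Ioc
  have ht0 : 0 < t := ht.1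
  have hquot : 1 + t⁻¹ ^ 2 = (1 + t ^ 2) / t ^ 2 := by field_simp; ring
  simp only [hquot, Real.log_div (x := 1 + t ^ 2) (y := t ^ 2) (by positivity) (by positivity),
    Real.log_pow, Nat.cast_ofNat]

theorem integrableOn_Ioi_log_one_add_inv_sq {b : ℝ} (hb : 0 < b) :
    IntegrableOn (fun t : ℝ => Real.log (1 + t⁻¹ ^ 2)) (Ioi b) := by
  have hpow : IntegrableOn (fun t : ℝ => t ^ (-2 : ℤ)) (Ioi b) := by
    have h := integrableOn_Ioi_rpow_of_lt (a := (-2 : ℤ)) (by norm_num) hb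
    simpa only [Real.rpow_intCast] using h
  refine hpow.mono' (Measurable.log (by fun_prop)).aestronglyMeasurable (.of_forall fun t => ?_)
  have hlog := Real.log_le_sub_one_of_pos (show (0 : ℝ) < 1 + t⁻¹ ^ 2 by positivity)
  rw [Real.norm_of_nonneg (Real.log_nonneg (le_add_of_nonneg_right (by positivity)))]
  simpa only [add_sub_cancel_left, inv_pow, zpow_neg, zpow_ofNat] using hlog

theorem integrableOn_log_one_add_inv_sq :
    IntegrableOn (fun t : ℝ => Real.log (1 + t⁻¹ ^ 2)) (Ioi 0) := by
  rw [← Ioc_union_Ioi_eq_Ioi (zero_le_one' ℝ)]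
  exact (integrableOn_Ioc_log_one_add_inv_sq 1).union
    (integrableOn_Ioi_log_one_add_inv_sq one_pos)

theorem integral_log_one_add_inv_sq_pos :
    0 < ∫ t in Ioi (0 : ℝ), Real.log (1 + t⁻¹ ^ 2) :=
  setIntegral_pos_of_pos measurableSet_Ioi (by simp) integrableOn_log_one_add_inv_sq
    fun t (ht : 0 < t) => Real.log_pos (lt_add_of_pos_right 1 (by positivity))

theorem one_add_div_sq_eq (a t : ℝ) : 1 + (a / t) ^ 2 = 1 + (|a|⁻¹ * t)⁻¹ ^ 2 := by
  simp [mul_pow, div_eq_mul_inv, mul_comm]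

theorem integrableOn_log_one_add_div_sq (a : ℝ) :
    IntegrableOn (fun t : ℝ => Real.log (1 + (a / t) ^ 2)) (Ioi 0) := by
  rcases eq_or_ne a 0 with rfl | ha
  · simp
  simp only [one_add_div_sq_eq a]
  rw [integrableOn_Ioi_comp_mul_left_iff (fun t => Real.log (1 + t⁻¹ ^ 2)) 0
    (inv_pos.2 (abs_pos.2 ha)), mul_zero]
  exact integrableOn_log_one_add_inv_sq

theorem integral_log_one_add_div_sq (a : ℝ) :
    ∫ t in Ioi (0 : ℝ), Real.log (1 + (a / t) ^ 2) =
      |a| * ∫ t in Ioi (0 : ℝ), Real.log (1 + t⁻¹ ^ 2) := by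
  rcases eq_or_ne a 0 with rfl | ha
  · simp
  simp only [one_add_div_sq_eq a]
  rw [integral_comp_mul_left_Ioi (fun t => Real.log (1 + t⁻¹ ^ 2)) 0 (inv_pos.2 (abs_pos.2 ha)),
    mul_zero, inv_inv, smul_eq_mul]

variable {ι : Type*} [Fintype ι]

theorem sum_log_one_add_div_sq (a : ι → ℝ) {t : ℝ} (ht : t ≠ 0) :
    ∑ j, Real.log (1 + (a j / t) ^ 2) =
      Real.log (∏ j, (t ^ 2 + a j ^ 2)) - Fintype.card ι * Real.log (t ^ 2) := by
  have hlog (j : ι) : Real.log (1 + (a j / t) ^ 2) =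
      Real.log (t ^ 2 + a j ^ 2) - Real.log (t ^ 2) := by
    rw [← Real.log_div (by positivity) (by positivity)]
    congr 1
    field_simp
  simp only [hlog, Finset.sum_sub_distrib, Finset.sum_const, Finset.card_univ, nsmul_eq_mul]
  rw [Real.log_prod fun j _ => by positivity]

theorem integrableOn_sum_log_one_add_div_sq (a : ι → ℝ) :
    IntegrableOn (fun t : ℝ => ∑ j, Real.log (1 + (a j / t) ^ 2)) (Ioi 0) :=
  integrable_finsetSum _ fun j _ => integrableOn_log_one_add_div_sq (a j)

theorem integral_sum_log_one_add_div_sq (a : ι → ℝ) :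
    ∫ t in Ioi (0 : ℝ), ∑ j, Real.log (1 + (a j / t) ^ 2) =
      (∑ j, |a j|) * ∫ t in Ioi (0 : ℝ), Real.log (1 + t⁻¹ ^ 2) := by
  rw [integral_finsetSum _ fun j _ => integrableOn_log_one_add_div_sq (a j), Finset.sum_mul]
  exact Finset.sum_congr rfl fun j _ => integral_log_one_add_div_sq (a j)

variable {a b : ι → ℝ}

theorem sum_abs_le_of_prod_le
    (h : ∀ t : ℝ, 0 < t → ∏ j, (t ^ 2 + a j ^ 2) ≤ ∏ j, (t ^ 2 + b j ^ 2)) :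
    ∑ j, |a j| ≤ ∑ j, |b j| := by
  refine le_of_mul_le_mul_right ?_ integral_log_one_add_inv_sq_pos
  rw [← integral_sum_log_one_add_div_sq, ← integral_sum_log_one_add_div_sq]
  refine setIntegral_mono_on (integrableOn_sum_log_one_add_div_sq a)
    (integrableOn_sum_log_one_add_div_sq b) measurableSet_Ioi fun t (ht : 0 < t) => ?_
  rw [sum_log_one_add_div_sq a ht.ne', sum_log_one_add_div_sq b ht.ne']
  exact sub_le_sub_right (Real.log_le_log (Finset.prod_pos fun j _ => by positivity) (h t ht)) _

theorem sum_abs_lt_of_prod_lt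
    (h : ∀ t : ℝ, 0 < t → ∏ j, (t ^ 2 + a j ^ 2) < ∏ j, (t ^ 2 + b j ^ 2)) :
    ∑ j, |a j| < ∑ j, |b j| := by
  refine lt_of_mul_lt_mul_right ?_ integral_log_one_add_inv_sq_pos.le
  rw [← integral_sum_log_one_add_div_sq, ← integral_sum_log_one_add_div_sq, ← sub_pos,
    ← integral_sub (integrableOn_sum_log_one_add_div_sq b) (integrableOn_sum_log_one_add_div_sq a)]
  refine setIntegral_pos_of_pos measurableSet_Ioi (by simp)
    ((integrableOn_sum_log_one_add_div_sq b).sub (integrableOn_sum_log_one_add_div_sq a))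
    fun t (ht : 0 < t) => ?_
  rw [sum_log_one_add_div_sq a ht.ne', sum_log_one_add_div_sq b ht.ne', sub_sub_sub_cancel_right,
    sub_pos]
  exact Real.log_lt_log (Finset.prod_pos fun j _ => by positivity) (h t ht)

end Coulson

section ShiftMatrix

open Matrix

theorem norm_det_add_I_smul_sq {n : Type*} [Fintype n] [DecidableEq n] {A : Matrix n n ℂ}
    (hA : A.IsHermitian) (t : ℝ) :
    ‖((t : ℂ) • (1 : Matrix n n ℂ) + Complex.I • A).det‖ ^ 2 =
      ∏ j, (t ^ 2 + hA.eigenvalues j ^ 2) := by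
  have hrot : (t : ℂ) • (1 : Matrix n n ℂ) + Complex.I • A =
      (-Complex.I) • (scalar n (Complex.I * t) - A) := by
    have hI : -Complex.I * (Complex.I * t) = t := by
      rw [← mul_assoc, neg_mul, Complex.I_mul_I, neg_neg, one_mul]
    rw [scalar_apply, ← smul_one_eq_diagonal, smul_sub, smul_smul, hI, neg_smul, sub_neg_eq_add]
  rw [hrot, det_smul, ← eval_charpoly, hA.charpoly_eq, Polynomial.eval_prod, norm_mul, norm_pow,
    norm_neg, Complex.norm_I, one_pow, one_mul, norm_prod, ← Finset.prod_pow]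
  refine Finset.prod_congr rfl fun j _ => ?_
  have hfactor : Polynomial.eval (Complex.I * t) (Polynomial.X - Polynomial.C
      (hA.eigenvalues j : ℂ)) = (-hA.eigenvalues j : ℝ) + t * Complex.I := by
    simp only [Polynomial.eval_sub, Polynomial.eval_X, Polynomial.eval_C]
    push_cast
    ring
  rw [Complex.sq_norm]
  exact (congrArg _ hfactor).trans ((Complex.normSq_add_mul_I _ _).trans (by ring))

end ShiftMatrix

namespace UnitGainGraph

variable {V : Type*} [DecidableEq V] {G : SimpleGraph V}

/-- The matrix `t + i A(Φ)`. It has squared modulus of determinant `∏ (t² + λ_j²)`, and up to the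
diagonal it is skew-Hermitian with opposite entries of product `-1`. -/
noncomputable def shiftMatrix (Φ : UnitGainGraph G) (t : ℝ) : Matrix V V ℂ :=
  (t : ℂ) • (1 : Matrix V V ℂ) + Complex.I • Φ.adjMatrix

variable (Φ : UnitGainGraph G) (t : ℝ) {u v : V}

theorem shiftMatrix_self (u : V) : Φ.shiftMatrix t u u = t := by
  simp [shiftMatrix, adjMatrix]

theorem shiftMatrix_of_adj (h : G.Adj u v) :
    Φ.shiftMatrix t u v = Complex.I * Φ.gain ⟨(u, v), h⟩ := by
  simp [shiftMatrix, adjMatrix, h, h.ne]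

theorem shiftMatrix_of_not_adj (hne : u ≠ v) (h : ¬G.Adj u v) : Φ.shiftMatrix t u v = 0 := by
  simp [shiftMatrix, adjMatrix, h, hne]

theorem shiftMatrix_of_adj_symm (h : G.Adj u v) :
    Φ.shiftMatrix t v u = Complex.I * starRingEnd ℂ (Φ.gain ⟨(u, v), h⟩ : ℂ) := by
  rw [Φ.shiftMatrix_of_adj t h.symm, ← Circle.coe_inv_eq_conj, ← Φ.gain_symm ⟨(u, v), h⟩]
  rfl

theorem shiftMatrix_mul_symm (h : G.Adj u v) :
    Φ.shiftMatrix t u v * Φ.shiftMatrix t v u = -1 := by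
  rw [Φ.shiftMatrix_of_adj_symm t h, Φ.shiftMatrix_of_adj t h, mul_mul_mul_comm, Complex.I_mul_I,
    ← Circle.coe_inv_eq_conj, Circle.coe_inv, mul_inv_cancel₀ (Circle.coe_ne_zero _), mul_one]

variable [Fintype V] {Φ} {Ψ : UnitGainGraph G}

theorem energy_le_of_norm_det_le
    (h : ∀ t : ℝ, 0 < t → ‖(Φ.shiftMatrix t).det‖ ≤ ‖(Ψ.shiftMatrix t).det‖) :
    Φ.energy ≤ Ψ.energy :=
  sum_abs_le_of_prod_le fun t ht => by
    simpa only [shiftMatrix, norm_det_add_I_smul_sq, adjMatrix_isHermitian] using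
      pow_le_pow_left₀ (norm_nonneg _) (h t ht) 2

theorem energy_lt_of_norm_det_lt
    (h : ∀ t : ℝ, 0 < t → ‖(Φ.shiftMatrix t).det‖ < ‖(Ψ.shiftMatrix t).det‖) :
    Φ.energy < Ψ.energy :=
  sum_abs_lt_of_prod_lt fun t ht => by
    simpa only [shiftMatrix, norm_det_add_I_smul_sq, adjMatrix_isHermitian] using
      pow_lt_pow_left₀ (h t ht) (norm_nonneg _) two_ne_zero

end UnitGainGraph

section Continuant

/-- The continuant of the sequence `d 0, …, d (n - 1)`, with signs chosen so that it is the
determinant of a tridiagonal matrix with diagonal `d` whose opposite off-diagonal entries have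
product `-1`. -/
def continuant {R : Type*} [Semiring R] : ∀ {n : ℕ}, (Fin n → R) → R
  | 0, _ => 1
  | 1, d => d 0
  | _ + 2, d => d 0 * continuant (Fin.tail d) + continuant (Fin.tail (Fin.tail d))

theorem map_continuant {R S : Type*} [Semiring R] [Semiring S] (f : R →+* S) :
    ∀ {n : ℕ} (d : Fin n → R), f (continuant d) = continuant (f ∘ d)
  | 0, _ => map_one f
  | 1, _ => rfl
  | _ + 2, d => by
    rw [continuant, map_add, map_mul, map_continuant f (Fin.tail d),
      map_continuant f (Fin.tail (Fin.tail d))]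
    rfl

variable {R : Type*} [Semiring R] [PartialOrder R] [IsStrictOrderedRing R]

theorem continuant_pos : ∀ {n : ℕ} {d : Fin n → R}, (∀ i, 0 < d i) → 0 < continuant d
  | 0, _, _ => one_pos
  | 1, _, hd => hd 0
  | _ + 2, _, hd => add_pos (mul_pos (hd 0) (continuant_pos fun i => hd i.succ))
      (continuant_pos fun i => hd i.succ.succ)

theorem one_le_continuant_of_even :
    ∀ {n : ℕ} {d : Fin n → R}, Even n → (∀ i, 0 < d i) → 1 ≤ continuant d
  | 0, _, _, _ => le_rfl
  | 1, _, h, _ => absurd h (by decide)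
  | n + 2, d, h, hd =>
    le_add_of_nonneg_of_le (mul_pos (hd 0) (continuant_pos fun i => hd i.succ)).le
      (one_le_continuant_of_even (by simpa [Nat.even_add] using h) fun i => hd i.succ.succ)

theorem continuant_strictMonoOn :
    ∀ {n : ℕ}, StrictMonoOn (continuant : (Fin n → R) → R) {d | ∀ i, 0 < d i}
  | 0, _, _, _, _, hlt => absurd (Subsingleton.elim _ _) hlt.ne
  | 1, d, _, e, _, hlt => by
    obtain ⟨-, i, hi⟩ := Pi.lt_def.1 hlt
    rwa [Subsingleton.elim i 0] at hi
  | n + 2, d, hd, e, he, hlt => by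
    have htail : Fin.tail d ≤ Fin.tail e := fun i => hlt.le i.succ
    have htail_le : continuant (Fin.tail d) ≤ continuant (Fin.tail e) :=
      continuant_strictMonoOn.monotoneOn (fun i => hd i.succ) (fun i => he i.succ) htail
    have htail_tail_le : continuant (Fin.tail (Fin.tail d)) ≤ continuant (Fin.tail (Fin.tail e)) :=
      continuant_strictMonoOn.monotoneOn (fun i => hd i.succ.succ) (fun i => he i.succ.succ)
        fun i => htail i.succ
    refine add_lt_add_of_lt_of_le ?_ htail_tail_le
    rcases (hlt.le 0).lt_or_eq with h0 | h0
    · exact mul_lt_mul h0 htail_le (continuant_pos fun i => hd i.succ) (he 0).le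
    · have htail_lt : Fin.tail d < Fin.tail e := htail.lt_of_ne fun h => hlt.ne <| by
        rw [← Fin.cons_self_tail d, ← Fin.cons_self_tail e, h0, h]
      rw [h0]
      exact mul_lt_mul_of_pos_left
        (continuant_strictMonoOn (fun i => hd i.succ) (fun i => he i.succ) htail_lt) (he 0)

end Continuant

section Tridiagonal

open Matrix

variable {R : Type*} [CommRing R]

/-- Tridiagonal matrices whose opposite off-diagonal entries have product `-1`, such as `t + i A`
for the adjacency matrix `A` of a gain graph on a path. -/
structure IsSkewTridiagonal {n : ℕ} (M : Matrix (Fin n) (Fin n) R) : Prop where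
  mul_symm : ∀ {i j : Fin n}, i.val + 1 = j.val → M i j * M j i = -1
  upper : ∀ {i j : Fin n}, i.val + 1 < j.val → M i j = 0
  lower : ∀ {i j : Fin n}, i.val + 1 < j.val → M j i = 0

namespace IsSkewTridiagonal

theorem sub_diagonal {n : ℕ} {M : Matrix (Fin n) (Fin n) R} (h : IsSkewTridiagonal M)
    (d : Fin n → R) : IsSkewTridiagonal (M - diagonal d) := by
  have hoff {i j : Fin n} (hij : i.val < j.val) :
      (M - diagonal d) i j = M i j ∧ (M - diagonal d) j i = M j i := by
    have hne : i ≠ j := Fin.ne_of_lt hij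
    simp [hne, hne.symm]
  constructor <;> intro i j hij
  · rw [(hoff (by omega)).1, (hoff (by omega)).2, h.mul_symm hij]
  · rw [(hoff (by omega)).1, h.upper hij]
  · rw [(hoff (by omega)).2, h.lower hij]

theorem submatrix_succ {n : ℕ} {M : Matrix (Fin (n + 1)) (Fin (n + 1)) R}
    (h : IsSkewTridiagonal M) : IsSkewTridiagonal (M.submatrix Fin.succ Fin.succ) where
  mul_symm hij := h.mul_symm (by simp [hij])
  upper hij := h.upper (by simpa using hij)
  lower hij := h.lower (by simpa using hij)

theorem submatrix_castSucc {n : ℕ} {M : Matrix (Fin (n + 1)) (Fin (n + 1)) R}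
    (h : IsSkewTridiagonal M) : IsSkewTridiagonal (M.submatrix Fin.castSucc Fin.castSucc) where
  mul_symm hij := h.mul_symm hij
  upper hij := h.upper hij
  lower hij := h.lower hij

theorem det_eq_continuant : ∀ {n : ℕ} {M : Matrix (Fin n) (Fin n) R},
    IsSkewTridiagonal M → M.det = continuant M.diag
  | 0, M, _ => det_fin_zero
  | 1, M, _ => det_fin_one M
  | n + 2, M, h => by
    have hrow (i : Fin n) : M 0 i.succ.succ = 0 := h.upper (by simp)
    have hcol (i : Fin n) : M i.succ.succ 0 = 0 := h.lower (by simp)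
    have hminor : (M.submatrix Fin.succ (Fin.succAbove 1)).det =
        M 1 0 * (M.submatrix (Fin.succ ∘ Fin.succ) (Fin.succ ∘ Fin.succ)).det := by
      have hsub : (M.submatrix Fin.succ (Fin.succAbove 1)).submatrix Fin.succ Fin.succ =
          M.submatrix (Fin.succ ∘ Fin.succ) (Fin.succ ∘ Fin.succ) := by
        ext i j
        simp
      rw [det_succ_column_zero, Fin.sum_univ_succ, Fin.succAbove_zero, hsub]
      simp [hcol]
    have hprod : M 0 1 * M 1 0 = -1 := h.mul_symm (by simp)
    calc M.det = M 0 0 * (M.submatrix Fin.succ Fin.succ).det -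
          M 0 1 * (M.submatrix Fin.succ (Fin.succAbove 1)).det := by
          rw [det_succ_row_zero, Fin.sum_univ_succ, Fin.sum_univ_succ, Fin.succAbove_zero]
          simp [hrow, sub_eq_add_neg]
      _ = M 0 0 * (M.submatrix Fin.succ Fin.succ).det +
          (M.submatrix (Fin.succ ∘ Fin.succ) (Fin.succ ∘ Fin.succ)).det := by
          rw [hminor, ← mul_assoc, hprod, neg_one_mul, sub_neg_eq_add]
      _ = continuant M.diag := by
          rw [h.submatrix_succ.det_eq_continuant, ← submatrix_submatrix,
            h.submatrix_succ.submatrix_succ.det_eq_continuant]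
          rfl

variable {n : ℕ} {M : Matrix (Fin (n + 1)) (Fin (n + 1)) R}

theorem adjugate_zero_zero (h : IsSkewTridiagonal M) :
    M.adjugate 0 0 = continuant (Fin.tail M.diag) := by
  rw [adjugate_fin_succ_eq_det_submatrix, Fin.succAbove_zero, h.submatrix_succ.det_eq_continuant,
    Even.neg_one_pow ⟨_, rfl⟩, one_mul]
  rfl

theorem adjugate_last_last (h : IsSkewTridiagonal M) :
    M.adjugate (Fin.last n) (Fin.last n) = continuant (Fin.init M.diag) := by
  rw [adjugate_fin_succ_eq_det_submatrix, Fin.succAbove_last,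
    h.submatrix_castSucc.det_eq_continuant, Even.neg_one_pow ⟨_, rfl⟩, one_mul]
  rfl

theorem adjugate_zero_last (h : IsSkewTridiagonal M) :
    M.adjugate 0 (Fin.last n) = (-1) ^ n * ∏ i : Fin n, M i.castSucc i.succ := by
  have htri : (M.submatrix Fin.castSucc Fin.succ).IsLowerTriangular :=
    fun i j hij => h.upper (by simpa using hij)
  rw [adjugate_fin_succ_eq_det_submatrix, Fin.succAbove_last, Fin.succAbove_zero,
    det_of_isLowerTriangular _ htri]
  simp

theorem adjugate_last_zero (h : IsSkewTridiagonal M) :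
    M.adjugate (Fin.last n) 0 = (-1) ^ n * ∏ i : Fin n, M i.succ i.castSucc := by
  have htri : (M.submatrix Fin.succ Fin.castSucc).IsUpperTriangular :=
    fun i j hij => h.lower (by simpa using hij)
  rw [adjugate_fin_succ_eq_det_submatrix, Fin.succAbove_last, Fin.succAbove_zero,
    det_of_isUpperTriangular htri]
  simp

theorem dotProduct_adjugate_mulVec (h : IsSkewTridiagonal M) (x₀ x₁ y₀ y₁ : R) :
    (Pi.single 0 x₀ + Pi.single (Fin.last n) x₁) ⬝ᵥ
        M.adjugate *ᵥ (Pi.single 0 y₀ + Pi.single (Fin.last n) y₁) =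
      x₀ * y₀ * continuant (Fin.tail M.diag) + x₁ * y₁ * continuant (Fin.init M.diag) +
        (-1) ^ n * (x₀ * (∏ i : Fin n, M i.castSucc i.succ) * y₁ +
          x₁ * (∏ i : Fin n, M i.succ i.castSucc) * y₀) := by
  simp only [mulVec_add, dotProduct_add, add_dotProduct, mulVec_single, single_dotProduct,
    Pi.smul_apply, col_apply, MulOpposite.smul_eq_mul_unop, MulOpposite.unop_op,
    h.adjugate_zero_zero, h.adjugate_last_last, h.adjugate_zero_last, h.adjugate_last_zero]
  ring

end IsSkewTridiagonal

end Tridiagonal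

section SchurComplement

open Matrix

variable {R m₁ m₂ n V : Type*} [CommRing R] [Fintype m₁] [Fintype n]
  [DecidableEq m₁] [DecidableEq n]

theorem det_fromBlocks_of_coupled_at {A : Matrix m₁ m₁ R} {B : Matrix m₁ n R} {C : Matrix n m₁ R}
    (D : Matrix n n R) (hA : IsUnit A.det) {v : n}
    (h : ∀ i j, j ≠ v → B i j = 0 ∧ C j i = 0) :
    (fromBlocks A B C D).det =
      A.det * (D - diagonal (Pi.single v (C v ⬝ᵥ A⁻¹ *ᵥ fun i => B i v))).det := by
  have hCAB : C * A⁻¹ * B = diagonal (Pi.single v (C v ⬝ᵥ A⁻¹ *ᵥ fun i => B i v)) := by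
    ext j k
    have hentry : (C * A⁻¹ * B) j k = C j ⬝ᵥ A⁻¹ *ᵥ fun i => B i k := by
      rw [Matrix.mul_assoc]
      rfl
    rcases eq_or_ne j v with rfl | hj
    · rcases eq_or_ne k j with rfl | hk
      · rw [hentry, diagonal_apply_eq, Pi.single_eq_same]
      · have hBk : (fun i => B i k) = 0 := funext fun i => (h i k hk).1
        rw [hentry, hBk, mulVec_zero, dotProduct_zero, diagonal_apply_ne _ hk.symm]
    · have hCj : C j = 0 := funext fun i => (h i j hj).2
      rw [hentry, hCj, zero_dotProduct, diagonal_single, single_apply_of_row_ne hj.symm]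
  let _ := invertibleOfIsUnitDet A hA
  rw [det_fromBlocks₁₁, invOf_eq_nonsing_inv, hCAB]

variable [Fintype m₂] [Fintype V] [DecidableEq m₂] [DecidableEq V]

theorem det_eq_of_two_pendants (M : Matrix V V R) {f₁ : m₁ → V} {f₂ : m₂ → V} {g : n → V}
    (hfg : Function.Bijective (Sum.elim f₁ (Sum.elim f₂ g))) (u v : n)
    (hf₁ : IsUnit (M.submatrix f₁ f₁).det) (hf₂ : IsUnit (M.submatrix f₂ f₂).det)
    (h₁₂ : ∀ i j, M (f₁ i) (f₂ j) = 0 ∧ M (f₂ j) (f₁ i) = 0)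
    (h₁ : ∀ i k, k ≠ u → M (f₁ i) (g k) = 0 ∧ M (g k) (f₁ i) = 0)
    (h₂ : ∀ j k, k ≠ v → M (f₂ j) (g k) = 0 ∧ M (g k) (f₂ j) = 0) :
    M.det = (M.submatrix f₁ f₁).det * ((M.submatrix f₂ f₂).det * (M.submatrix g g -
      diagonal
        (Pi.single u ((fun i => M (g u) (f₁ i)) ⬝ᵥ (M.submatrix f₁ f₁)⁻¹ *ᵥ
          fun i => M (f₁ i) (g u)) +
        Pi.single v ((fun j => M (g v) (f₂ j)) ⬝ᵥ (M.submatrix f₂ f₂)⁻¹ *ᵥ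
          fun j => M (f₂ j) (g v)))).det) := by
  let e := Equiv.ofBijective _ hfg
  have hM : M.submatrix e e = fromBlocks (M.submatrix f₁ f₁) (M.submatrix f₁ (Sum.elim f₂ g))
      (M.submatrix (Sum.elim f₂ g) f₁) (M.submatrix (Sum.elim f₂ g) (Sum.elim f₂ g)) := by
    ext (i | i) (j | j) <;> rfl
  have hcoupled₁ (i : m₁) (j : m₂ ⊕ n) (hj : j ≠ .inr u) :
      M.submatrix f₁ (Sum.elim f₂ g) i j = 0 ∧ M.submatrix (Sum.elim f₂ g) f₁ j i = 0 := by
    rcases j with j | k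
    exacts [h₁₂ i j, h₁ i k fun hk => hj (congrArg _ hk)]
  have hcoupled₂ (j : m₂) (k : n) (hk : k ≠ v) :
      M.submatrix f₂ g j k = 0 ∧ M.submatrix g f₂ k j = 0 := h₂ j k hk
  have hblocks (x : R) : M.submatrix (Sum.elim f₂ g) (Sum.elim f₂ g) -
      diagonal (Pi.single (.inr u) x) = fromBlocks (M.submatrix f₂ f₂) (M.submatrix f₂ g)
        (M.submatrix g f₂) (M.submatrix g g - diagonal (Pi.single u x)) := by
    ext (i | i) (j | j) <;> simp [diagonal_apply, Pi.single_apply]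
  rw [← det_submatrix_equiv_self e M, hM, det_fromBlocks_of_coupled_at _ hf₁ hcoupled₁, hblocks,
    det_fromBlocks_of_coupled_at _ hf₂ hcoupled₂, sub_sub, diagonal_add]
  rfl

end SchurComplement

section Cycle

open Matrix SimpleGraph

theorem eq_single_add_single {ι R : Type*} [DecidableEq ι] [AddZeroClass R] {f : ι → R} {a b : ι}
    (hab : a ≠ b) (hf : ∀ k, k ≠ a → k ≠ b → f k = 0) :
    f = Pi.single a (f a) + Pi.single b (f b) := by
  funext k
  rcases eq_or_ne k a with rfl | ha
  · simp [hab]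
  rcases eq_or_ne k b with rfl | hb
  · simp [hab.symm]
  · simp [ha, hb, hf k ha hb]

theorem prod_finRotate {R : Type*} [CommMonoid R] {n : ℕ} (f : Fin (n + 2) → Fin (n + 2) → R) :
    ∏ i, f i (finRotate (n + 2) i) =
      f 0 1 * (∏ i : Fin n, f i.castSucc.succ i.succ.succ) * f (Fin.last (n + 1)) 0 := by
  rw [Fin.prod_univ_castSucc, Fin.prod_univ_succ, finRotate_last]
  simp only [finRotate_apply, Fin.coeSucc_eq_succ, Fin.castSucc_zero, Fin.succ_castSucc, zero_add]

theorem cycleGraph_adj_iff_eq_add_one {n : ℕ} {i j : Fin (n + 2)} :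
    (cycleGraph (n + 2)).Adj i j ↔ i = j + 1 ∨ j = i + 1 := by
  rw [cycleGraph_adj, sub_eq_iff_eq_add', sub_eq_iff_eq_add']

theorem cycleGraph_adj_succ_succ {n : ℕ} {i j : Fin (n + 1)} :
    (cycleGraph (n + 2)).Adj i.succ j.succ ↔ (pathGraph (n + 1)).Adj i j := by
  rw [cycleGraph_adj_iff_eq_add_one, pathGraph_adj]
  simp only [Fin.ext_iff, Fin.val_add_one, Fin.val_succ, Fin.val_last]
  grind

theorem cycleGraph_adj_zero_succ {n : ℕ} {k : Fin (n + 1)} :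
    (cycleGraph (n + 2)).Adj 0 k.succ ↔ k = 0 ∨ k = Fin.last n := by
  rw [cycleGraph_adj_iff_eq_add_one]
  simp only [Fin.ext_iff, Fin.val_add_one, Fin.val_succ, Fin.val_last, Fin.val_zero]
  grind

/-- The path obtained from a cycle by deleting vertex `0`, as an induced subgraph. -/
def cycleTailEmbedding (n : ℕ) : pathGraph (n + 1) ↪g cycleGraph (n + 2) where
  toFun := Fin.succ
  inj' := Fin.succ_injective _
  map_rel_iff' := cycleGraph_adj_succ_succ

/-- For a cycle of even length `n + 2` on which the gains have parameter `x`, eliminating all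
vertices but the base vertex from `t + i A` adds this number to the diagonal entry `t` of the base
vertex. -/
noncomputable def cycleLoad (n : ℕ) (t x : ℝ) : ℝ :=
  (2 * continuant (fun _ : Fin n => t) - 2 * x) / continuant (fun _ : Fin (n + 1) => t)

theorem cycleLoad_nonneg {n : ℕ} (hn : Even n) {t x : ℝ} (ht : 0 < t) (hx : x ≤ 1) :
    0 ≤ cycleLoad n t x := by
  have h : 1 ≤ continuant fun _ : Fin n => t := one_le_continuant_of_even hn fun _ => ht
  exact div_nonneg (by linarith) (continuant_pos fun _ => ht).le

theorem cycleLoad_strictAnti (n : ℕ) {t : ℝ} (ht : 0 < t) : StrictAnti (cycleLoad n t) :=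
  fun x y hxy => div_lt_div_of_pos_right (by linarith) (continuant_pos fun _ => ht)

theorem continuant_const_ofReal (n : ℕ) (t : ℝ) :
    continuant (fun _ : Fin n => (t : ℂ)) = (continuant fun _ : Fin n => t : ℝ) :=
  (map_continuant Complex.ofRealHom _).symm

namespace UnitGainGraph

variable {V : Type*} {G : SimpleGraph V} (Φ : UnitGainGraph G)

/-- The parameter `(-1)^{n/2} Re γ` of a cycle of even length `n` with gain `γ`, denoted by `α` and
`β` for the two cycles of a dumbbell graph. -/
noncomputable def cycleParam {n : ℕ} (hn : 3 ≤ n) (c : cycleGraph n →g G) : ℝ :=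
  (-1) ^ (n / 2) * (Φ.cycleGain hn c : ℂ).re

theorem abs_cycleParam_le_one {n : ℕ} (hn : 3 ≤ n) (c : cycleGraph n →g G) :
    |Φ.cycleParam hn c| ≤ 1 := by
  rw [cycleParam, abs_mul, abs_neg_one_pow, one_mul]
  exact (Complex.abs_re_le_norm _).trans_eq (Circle.norm_coe _)

variable [DecidableEq V] (t : ℝ) {n : ℕ}

theorem isSkewTridiagonal_shiftMatrix_submatrix (f : pathGraph n ↪g G) :
    IsSkewTridiagonal ((Φ.shiftMatrix t).submatrix f f) := by
  have hfar {i j : Fin n} (hij : i.val + 1 < j.val) : f i ≠ f j ∧ ¬G.Adj (f i) (f j) := by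
    rw [f.injective.ne_iff, f.map_adj_iff, pathGraph_adj, Ne, Fin.ext_iff]
    omega
  constructor <;> intro i j hij
  · exact Φ.shiftMatrix_mul_symm t (f.map_adj_iff.2 (pathGraph_adj.2 (Or.inl hij)))
  · exact Φ.shiftMatrix_of_not_adj t (hfar hij).1 (hfar hij).2
  · exact Φ.shiftMatrix_of_not_adj t (hfar hij).1.symm fun h => (hfar hij).2 h.symm

theorem diag_shiftMatrix_submatrix {m : Type*} (f : m → V) :
    ((Φ.shiftMatrix t).submatrix f f).diag = fun _ => (t : ℂ) :=
  funext fun i => Φ.shiftMatrix_self t (f i)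

theorem prod_shiftMatrix_cycle (hn : 3 ≤ n) (c : cycleGraph n →g G) :
    ∏ i, Φ.shiftMatrix t (c i) (c (finRotate n i)) = Complex.I ^ n * Φ.cycleGain hn c := by
  simp only [Φ.shiftMatrix_of_adj t (c.map_adj (cycleGraph_adj_finRotate hn _)),
    Finset.prod_mul_distrib, Finset.prod_const, Finset.card_univ, Fintype.card_fin]
  exact congrArg _ (map_prod Circle.coeHom _ _).symm

theorem prod_shiftMatrix_cycle_symm (hn : 3 ≤ n) (c : cycleGraph n →g G) :
    ∏ i, Φ.shiftMatrix t (c (finRotate n i)) (c i) =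
      Complex.I ^ n * starRingEnd ℂ (Φ.cycleGain hn c) := by
  simp only [Φ.shiftMatrix_of_adj_symm t (c.map_adj (cycleGraph_adj_finRotate hn _)),
    Finset.prod_mul_distrib, Finset.prod_const, Finset.card_univ, Fintype.card_fin, ← map_prod]
  exact congrArg (fun z => _ * starRingEnd ℂ z) (map_prod Circle.coeHom _ _).symm

theorem prod_shiftMatrix_cycle_add_symm (hn : 3 ≤ n) (hne : Even n) (c : cycleGraph n →g G) :
    ∏ i, Φ.shiftMatrix t (c i) (c (finRotate n i)) +
      ∏ i, Φ.shiftMatrix t (c (finRotate n i)) (c i) = (2 * Φ.cycleParam hn c : ℝ) := by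
  have hI : Complex.I ^ n = (-1) ^ (n / 2) := by
    rw [← Complex.I_sq, ← pow_mul, Nat.mul_div_cancel' hne.two_dvd]
  rw [Φ.prod_shiftMatrix_cycle t hn c, Φ.prod_shiftMatrix_cycle_symm t hn c, ← mul_add,
    Complex.add_conj, hI, cycleParam]
  push_cast
  ring

variable (c : cycleGraph (n + 2) ↪g G)

theorem det_shiftMatrix_cycleTail :
    ((Φ.shiftMatrix t).submatrix (c ∘ Fin.succ) (c ∘ Fin.succ)).det =
      continuant fun _ : Fin (n + 1) => (t : ℂ) := by
  have h := Φ.isSkewTridiagonal_shiftMatrix_submatrix t ((cycleTailEmbedding n).trans c)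
  rw [← Φ.diag_shiftMatrix_submatrix t (c ∘ Fin.succ)]
  exact h.det_eq_continuant

variable {t} in
theorem isUnit_det_shiftMatrix_cycleTail (ht : 0 < t) :
    IsUnit ((Φ.shiftMatrix t).submatrix (c ∘ Fin.succ) (c ∘ Fin.succ)).det := by
  rw [Φ.det_shiftMatrix_cycleTail, continuant_const_ofReal, isUnit_iff_ne_zero,
    Complex.ofReal_ne_zero]
  exact (continuant_pos fun _ => ht).ne'

theorem shiftMatrix_zero_cycleTail (hn : n ≠ 0) :
    (fun k : Fin (n + 1) => Φ.shiftMatrix t (c 0) (c k.succ)) =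
        Pi.single 0 (Φ.shiftMatrix t (c 0) (c 1)) +
          Pi.single (Fin.last n) (Φ.shiftMatrix t (c 0) (c (Fin.last (n + 1)))) ∧
      (fun k : Fin (n + 1) => Φ.shiftMatrix t (c k.succ) (c 0)) =
        Pi.single 0 (Φ.shiftMatrix t (c 1) (c 0)) +
          Pi.single (Fin.last n) (Φ.shiftMatrix t (c (Fin.last (n + 1))) (c 0)) := by
  have hends : (0 : Fin (n + 1)) ≠ Fin.last n := by simpa [Fin.ext_iff] using hn.symm
  have hne (k : Fin (n + 1)) : c 0 ≠ c k.succ := c.injective.ne (Fin.succ_ne_zero k).symm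
  have hnadj (k : Fin (n + 1)) (h0 : k ≠ 0) (hl : k ≠ Fin.last n) : ¬G.Adj (c 0) (c k.succ) := by
    rw [c.map_adj_iff, cycleGraph_adj_zero_succ]
    exact not_or.2 ⟨h0, hl⟩
  exact ⟨eq_single_add_single hends fun k h0 hl =>
      Φ.shiftMatrix_of_not_adj t (hne k) (hnadj k h0 hl),
    eq_single_add_single hends fun k h0 hl =>
      Φ.shiftMatrix_of_not_adj t (hne k).symm fun h => hnadj k h0 hl h.symm⟩

theorem dotProduct_adjugate_cycleTail_mulVec (hn : 3 ≤ n + 2) (hne : Even n) :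
    (fun k : Fin (n + 1) => Φ.shiftMatrix t (c 0) (c k.succ)) ⬝ᵥ
        ((Φ.shiftMatrix t).submatrix (c ∘ Fin.succ) (c ∘ Fin.succ)).adjugate *ᵥ
          (fun k : Fin (n + 1) => Φ.shiftMatrix t (c k.succ) (c 0)) =
      2 * Φ.cycleParam hn c.toHom - 2 * continuant fun _ : Fin n => (t : ℂ) := by
  have htri : IsSkewTridiagonal ((Φ.shiftMatrix t).submatrix (c ∘ Fin.succ) (c ∘ Fin.succ)) :=
    Φ.isSkewTridiagonal_shiftMatrix_submatrix t ((cycleTailEmbedding n).trans c)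
  have hfirst : Φ.shiftMatrix t (c 0) (c 1) * Φ.shiftMatrix t (c 1) (c 0) = -1 :=
    Φ.shiftMatrix_mul_symm t (c.map_adj_iff.2 (cycleGraph_adj_zero_succ.2 (Or.inl rfl)))
  have hlast : Φ.shiftMatrix t (c 0) (c (Fin.last (n + 1))) *
      Φ.shiftMatrix t (c (Fin.last (n + 1))) (c 0) = -1 :=
    Φ.shiftMatrix_mul_symm t (c.map_adj_iff.2 (cycleGraph_adj_zero_succ.2 (Or.inr rfl)))
  have hprod : Φ.shiftMatrix t (c 0) (c 1) *
          (∏ i : Fin n, Φ.shiftMatrix t (c i.castSucc.succ) (c i.succ.succ)) *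
          Φ.shiftMatrix t (c (Fin.last (n + 1))) (c 0) +
        Φ.shiftMatrix t (c 1) (c 0) *
          (∏ i : Fin n, Φ.shiftMatrix t (c i.succ.succ) (c i.castSucc.succ)) *
          Φ.shiftMatrix t (c 0) (c (Fin.last (n + 1))) = (2 * Φ.cycleParam hn c.toHom : ℝ) := by
    rw [← prod_finRotate fun i j => Φ.shiftMatrix t (c i) (c j),
      ← prod_finRotate fun i j => Φ.shiftMatrix t (c j) (c i)]
    exact Φ.prod_shiftMatrix_cycle_add_symm t hn (by simpa [Nat.even_add] using hne) c.toHom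
  have htail : Fin.tail (fun _ : Fin (n + 1) => (t : ℂ)) = fun _ => (t : ℂ) := rfl
  have hinit : Fin.init (fun _ : Fin (n + 1) => (t : ℂ)) = fun _ => (t : ℂ) := rfl
  obtain ⟨hrow, hcol⟩ := Φ.shiftMatrix_zero_cycleTail t c (by omega)
  rw [hrow, hcol, htri.dotProduct_adjugate_mulVec, Φ.diag_shiftMatrix_submatrix, hfirst, hlast,
    hne.neg_one_pow, htail, hinit]
  simp only [submatrix_apply, Function.comp_apply]
  push_cast at hprod
  linear_combination hprod

theorem dotProduct_inv_cycleTail_mulVec (hn : 3 ≤ n + 2) (hne : Even n) :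
    (fun k : Fin (n + 1) => Φ.shiftMatrix t (c 0) (c k.succ)) ⬝ᵥ
        ((Φ.shiftMatrix t).submatrix (c ∘ Fin.succ) (c ∘ Fin.succ))⁻¹ *ᵥ
          (fun k : Fin (n + 1) => Φ.shiftMatrix t (c k.succ) (c 0)) =
      -(cycleLoad n t (Φ.cycleParam hn c.toHom) : ℂ) := by
  rw [inv_def, Φ.det_shiftMatrix_cycleTail, smul_mulVec, dotProduct_smul,
    Φ.dotProduct_adjugate_cycleTail_mulVec t c hn hne, Ring.inverse_eq_inv', smul_eq_mul, cycleLoad,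
    continuant_const_ofReal, continuant_const_ofReal]
  push_cast
  ring

end UnitGainGraph

end Cycle

section Dumbbell

open Matrix SimpleGraph

/-- The cycle `C_r` as an induced subgraph of the dumbbell graph. -/
def dumbbellEmbeddingLeft (r s ℓ : ℕ) : cycleGraph r ↪g dumbbellGraph r s ℓ where
  toFun i := .inl (.inl i)
  inj' := Sum.inl_injective.comp Sum.inl_injective
  map_rel_iff' := by simp [dumbbellGraph, dumbbellLink]

/-- The cycle `C_s` as an induced subgraph of the dumbbell graph. -/
def dumbbellEmbeddingRight (r s ℓ : ℕ) : cycleGraph s ↪g dumbbellGraph r s ℓ where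
  toFun j := .inl (.inr j)
  inj' := Sum.inl_injective.comp Sum.inr_injective
  map_rel_iff' := by simp [dumbbellGraph, dumbbellLink]

/-- The vertices of the joining path of the dumbbell graph, both ends included. -/
def dumbbellPathVertex (m n c : ℕ) : Fin (c + 2) → (Fin (m + 2) ⊕ Fin (n + 2)) ⊕ Fin c :=
  Fin.cons (.inl (.inl 0)) (Fin.snoc (fun p => .inr p) (.inl (.inr 0)))

variable {m n c : ℕ}

theorem dumbbellPathVertex_last : dumbbellPathVertex m n c (Fin.last (c + 1)) = .inl (.inr 0) := by
  simp [dumbbellPathVertex, ← Fin.succ_last]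

theorem dumbbellPathVertex_injective : Function.Injective (dumbbellPathVertex m n c) := by
  simp [dumbbellPathVertex, Fin.cons_injective_iff, Fin.snoc_injective_iff, Fin.range_snoc,
    Sum.inr_injective]

theorem inl_inl_succ_ne_dumbbellPathVertex (i : Fin (m + 1)) (k : Fin (c + 2)) :
    .inl (.inl i.succ) ≠ dumbbellPathVertex m n c k := by
  refine Fin.cases ?_ (Fin.lastCases ?_ fun p => ?_) k <;> simp [dumbbellPathVertex]

theorem inl_inr_succ_ne_dumbbellPathVertex (j : Fin (n + 1)) (k : Fin (c + 2)) :
    .inl (.inr j.succ) ≠ dumbbellPathVertex m n c k := by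
  refine Fin.cases ?_ (Fin.lastCases ?_ fun p => ?_) k <;> simp [dumbbellPathVertex]

theorem dumbbellGraph_adj_dumbbellPathVertex {i j : Fin (c + 2)} :
    (dumbbellGraph (m + 2) (n + 2) (c + 1)).Adj (dumbbellPathVertex m n c i)
      (dumbbellPathVertex m n c j) ↔ (pathGraph (c + 2)).Adj i j := by
  refine Fin.cases ?_ (Fin.lastCases ?_ fun p => ?_) i <;>
    refine Fin.cases ?_ (Fin.lastCases ?_ fun q => ?_) j <;>
    simp [dumbbellPathVertex, dumbbellGraph, dumbbellLink, pathGraph_adj] <;> omega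

theorem not_dumbbellGraph_adj_inl_inl_succ {k : Fin (c + 2)} (hk : k ≠ 0) (i : Fin (m + 1)) :
    ¬(dumbbellGraph (m + 2) (n + 2) (c + 1)).Adj (.inl (.inl i.succ))
      (dumbbellPathVertex m n c k) := by
  revert hk
  refine Fin.cases ?_ (Fin.lastCases ?_ fun p => ?_) k <;>
    simp [dumbbellPathVertex, dumbbellGraph, dumbbellLink]

theorem not_dumbbellGraph_adj_inl_inr_succ {k : Fin (c + 2)} (hk : k ≠ Fin.last (c + 1))
    (j : Fin (n + 1)) :
    ¬(dumbbellGraph (m + 2) (n + 2) (c + 1)).Adj (.inl (.inr j.succ))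
      (dumbbellPathVertex m n c k) := by
  revert hk
  refine Fin.cases ?_ (Fin.lastCases ?_ fun p => ?_) k <;>
    simp [dumbbellPathVertex, dumbbellGraph, dumbbellLink]

theorem not_dumbbellGraph_adj_inl_inl_succ_inl_inr (i : Fin (m + 1)) (j : Fin (n + 2)) :
    ¬(dumbbellGraph (m + 2) (n + 2) (c + 1)).Adj (.inl (.inl i.succ)) (.inl (.inr j)) := by
  simp [dumbbellGraph, dumbbellLink]

/-- The joining path of the dumbbell graph, both ends included, as an induced subgraph. -/
def dumbbellPath (m n c : ℕ) : pathGraph (c + 2) ↪g dumbbellGraph (m + 2) (n + 2) (c + 1) where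
  toFun := dumbbellPathVertex m n c
  inj' := dumbbellPathVertex_injective
  map_rel_iff' := dumbbellGraph_adj_dumbbellPathVertex

theorem bijective_sumElim_dumbbell : Function.Bijective
    (Sum.elim (dumbbellEmbeddingLeft (m + 2) (n + 2) (c + 1) ∘ Fin.succ)
      (Sum.elim (dumbbellEmbeddingRight (m + 2) (n + 2) (c + 1) ∘ Fin.succ)
        (dumbbellPath m n c))) := by
  rw [Fintype.bijective_iff_injective_and_card]
  refine ⟨?_, by simp only [Fintype.card_sum, Fintype.card_fin]; omega⟩
  refine ((dumbbellEmbeddingLeft _ _ _).injective.comp (Fin.succ_injective _)).sumElim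
    (((dumbbellEmbeddingRight _ _ _).injective.comp (Fin.succ_injective _)).sumElim
      (dumbbellPath m n c).injective inl_inr_succ_ne_dumbbellPathVertex) ?_
  rintro i (j | k)
  · exact fun h => Sum.inl_ne_inr (Sum.inl_injective h)
  · exact inl_inl_succ_ne_dumbbellPathVertex i k

/-- The diagonal of the Schur complement of `t + i A` onto the joining path, when the cycles have
parameters `p = (α, β)`. -/
noncomputable def dumbbellDiag (m n c : ℕ) (t : ℝ) (p : ℝ × ℝ) : Fin (c + 2) → ℝ :=
  (fun _ => t) +
    (Pi.single 0 (cycleLoad m t p.1) + Pi.single (Fin.last (c + 1)) (cycleLoad n t p.2))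

theorem dumbbellDiag_pos (hm : Even m) (hn : Even n) {t : ℝ} (ht : 0 < t) {p : ℝ × ℝ} (hp : p ≤ 1)
    (i : Fin (c + 2)) : 0 < dumbbellDiag m n c t p i := by
  have hload : (0 : Fin (c + 2) → ℝ) ≤
      Pi.single 0 (cycleLoad m t p.1) + Pi.single (Fin.last (c + 1)) (cycleLoad n t p.2) :=
    add_nonneg (Pi.single_nonneg.2 (cycleLoad_nonneg hm ht hp.1))
      (Pi.single_nonneg.2 (cycleLoad_nonneg hn ht hp.2))
  exact add_pos_of_pos_of_nonneg ht (hload i)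

theorem dumbbellDiag_strictAnti (m n c : ℕ) {t : ℝ} (ht : 0 < t) :
    StrictAnti (dumbbellDiag m n c t) := by
  refine Antitone.strictAnti_of_injective (fun p q hpq => ?_) fun p q hpq => ?_
  · exact add_le_add_right (add_le_add
      (Pi.single_mono 0 ((cycleLoad_strictAnti m ht).antitone hpq.1))
      (Pi.single_mono (Fin.last (c + 1)) ((cycleLoad_strictAnti n ht).antitone hpq.2))) _
  · have hfst := congrFun hpq 0
    have hsnd := congrFun hpq (Fin.last (c + 1))
    refine Prod.ext ((cycleLoad_strictAnti m ht).injective ?_)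
      ((cycleLoad_strictAnti n ht).injective ?_)
    · simpa [dumbbellDiag] using hfst
    · simpa [dumbbellDiag] using hsnd

/-- The parameters `(α, β)` of a gain graph on a dumbbell graph. -/
noncomputable def dumbbellParams {r s ℓ : ℕ} (hr : 3 ≤ r) (hs : 3 ≤ s)
    (Φ : UnitGainGraph (dumbbellGraph r s ℓ)) : ℝ × ℝ :=
  (alphaParam hr Φ, betaParam hs Φ)

namespace UnitGainGraph

section Determinant

variable (Φ : UnitGainGraph (dumbbellGraph (m + 2) (n + 2) (c + 1))) {t : ℝ}

theorem det_shiftMatrix_dumbbell_eq_mul_det_path (hm : 3 ≤ m + 2) (hn : 3 ≤ n + 2) (hme : Even m)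
    (hne : Even n) (ht : 0 < t) :
    (Φ.shiftMatrix t).det =
      continuant (fun _ : Fin (m + 1) => (t : ℂ)) * (continuant (fun _ : Fin (n + 1) => (t : ℂ)) *
        ((Φ.shiftMatrix t).submatrix (dumbbellPath m n c) (dumbbellPath m n c) -
          diagonal (Pi.single 0 (-(cycleLoad m t (alphaParam hm Φ) : ℂ)) +
            Pi.single (Fin.last (c + 1)) (-(cycleLoad n t (betaParam hn Φ) : ℂ)))).det) := by
  have hzero {u v : (Fin (m + 2) ⊕ Fin (n + 2)) ⊕ Fin c} (huv : u ≠ v)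
      (hadj : ¬(dumbbellGraph (m + 2) (n + 2) (c + 1)).Adj u v) :
      Φ.shiftMatrix t u v = 0 ∧ Φ.shiftMatrix t v u = 0 :=
    ⟨Φ.shiftMatrix_of_not_adj t huv hadj, Φ.shiftMatrix_of_not_adj t huv.symm (hadj ·.symm)⟩
  have hleft := Φ.dotProduct_inv_cycleTail_mulVec t (dumbbellEmbeddingLeft _ _ _) hm hme
  have hright := Φ.dotProduct_inv_cycleTail_mulVec t (dumbbellEmbeddingRight _ _ _) hn hne
  have hfirst : dumbbellPath m n c 0 = dumbbellEmbeddingLeft _ _ _ 0 := rfl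
  have hlast : dumbbellPath m n c (Fin.last (c + 1)) = dumbbellEmbeddingRight _ _ _ 0 :=
    dumbbellPathVertex_last
  rw [det_eq_of_two_pendants _ bijective_sumElim_dumbbell 0 (Fin.last (c + 1))
      (Φ.isUnit_det_shiftMatrix_cycleTail _ ht) (Φ.isUnit_det_shiftMatrix_cycleTail _ ht)
      (fun i j => hzero (fun h => Sum.inl_ne_inr (Sum.inl_injective h))
        (not_dumbbellGraph_adj_inl_inl_succ_inl_inr i j.succ))
      (fun i k hk => hzero (inl_inl_succ_ne_dumbbellPathVertex i k)
        (not_dumbbellGraph_adj_inl_inl_succ hk i))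
      (fun j k hk => hzero (inl_inr_succ_ne_dumbbellPathVertex j k)
        (not_dumbbellGraph_adj_inl_inr_succ hk j)),
    Φ.det_shiftMatrix_cycleTail, Φ.det_shiftMatrix_cycleTail, hfirst, hlast]
  simp only [Function.comp_apply]
  rw [hleft, hright]
  rfl

theorem det_shiftMatrix_dumbbell (hm : 3 ≤ m + 2) (hn : 3 ≤ n + 2) (hme : Even m)
    (hne : Even n) (ht : 0 < t) :
    (Φ.shiftMatrix t).det =
      (continuant (fun _ : Fin (m + 1) => t) * (continuant (fun _ : Fin (n + 1) => t) *
        continuant (dumbbellDiag m n c t (dumbbellParams hm hn Φ))) : ℝ) := by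
  have htri := Φ.isSkewTridiagonal_shiftMatrix_submatrix t (dumbbellPath m n c)
  have hdiag : Complex.ofRealHom ∘ dumbbellDiag m n c t (dumbbellParams hm hn Φ) =
      (fun _ => (t : ℂ)) - (Pi.single 0 (-(cycleLoad m t (alphaParam hm Φ) : ℂ)) +
        Pi.single (Fin.last (c + 1)) (-(cycleLoad n t (betaParam hn Φ) : ℂ))) := by
    funext k
    simp only [dumbbellDiag, dumbbellParams, Function.comp_apply, Pi.add_apply, Pi.sub_apply,
      Pi.single_apply]
    split_ifs <;> simp [sub_eq_add_neg, add_comm]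
  rw [Φ.det_shiftMatrix_dumbbell_eq_mul_det_path hm hn hme hne ht,
    (htri.sub_diagonal _).det_eq_continuant, diag_sub, diag_diagonal, diag_shiftMatrix_submatrix,
    ← hdiag, ← map_continuant, continuant_const_ofReal, continuant_const_ofReal]
  push_cast
  rfl

end Determinant

variable {r s ℓ : ℕ} (hr : 3 ≤ r) (hs : 3 ≤ s)

theorem dumbbellParams_mem_Icc (Φ : UnitGainGraph (dumbbellGraph r s ℓ)) :
    dumbbellParams hr hs Φ ∈ Set.Icc (-1) 1 :=
  have hleft := abs_le.1 (Φ.abs_cycleParam_le_one hr (dumbbellCycleLeft r s ℓ))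
  have hright := abs_le.1 (Φ.abs_cycleParam_le_one hs (dumbbellCycleRight r s ℓ))
  ⟨⟨hleft.1, hright.1⟩, ⟨hleft.2, hright.2⟩⟩

theorem exists_norm_det_shiftMatrix_dumbbell (hℓ : 1 ≤ ℓ) (hre : Even r) (hse : Even s) {t : ℝ}
    (ht : 0 < t) :
    ∃ F : ℝ × ℝ → ℝ, StrictAntiOn F (Set.Iic 1) ∧
      ∀ Φ : UnitGainGraph (dumbbellGraph r s ℓ),
        ‖(Φ.shiftMatrix t).det‖ = F (dumbbellParams hr hs Φ) := by
  obtain ⟨m, rfl⟩ : ∃ m, r = m + 2 := ⟨r - 2, by omega⟩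
  obtain ⟨n, rfl⟩ : ∃ n, s = n + 2 := ⟨s - 2, by omega⟩
  obtain ⟨c, rfl⟩ : ∃ c, ℓ = c + 1 := ⟨ℓ - 1, by omega⟩
  have hm : Even m := by simpa [Nat.even_add] using hre
  have hn : Even n := by simpa [Nat.even_add] using hse
  have hKm : 0 < continuant fun _ : Fin (m + 1) => t := continuant_pos fun _ => ht
  have hKn : 0 < continuant fun _ : Fin (n + 1) => t := continuant_pos fun _ => ht
  refine ⟨fun p => continuant (fun _ : Fin (m + 1) => t) *
    (continuant (fun _ : Fin (n + 1) => t) * continuant (dumbbellDiag m n c t p)),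
    fun p hp q hq hpq => ?_, fun Φ => ?_⟩
  · exact mul_lt_mul_of_pos_left (mul_lt_mul_of_pos_left (continuant_strictMonoOn
      (dumbbellDiag_pos hm hn ht hq) (dumbbellDiag_pos hm hn ht hp)
      (dumbbellDiag_strictAnti m n c ht hpq)) hKn) hKm
  · have hpos := continuant_pos
      (dumbbellDiag_pos (c := c) hm hn ht (dumbbellParams_mem_Icc hr hs Φ).2)
    rw [Φ.det_shiftMatrix_dumbbell hr hs hm hn ht, Complex.norm_real]
    exact Real.norm_of_nonneg (by positivity)

variable {hr hs} {Φ Ψ : UnitGainGraph (dumbbellGraph r s ℓ)}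

theorem energy_le_of_dumbbellParams_le (hℓ : 1 ≤ ℓ) (hre : Even r) (hse : Even s)
    (h : dumbbellParams hr hs Ψ ≤ dumbbellParams hr hs Φ) : Φ.energy ≤ Ψ.energy :=
  energy_le_of_norm_det_le fun t ht => by
    obtain ⟨F, hF, hdet⟩ := exists_norm_det_shiftMatrix_dumbbell hr hs hℓ hre hse ht
    rw [hdet, hdet]
    exact hF.antitoneOn (dumbbellParams_mem_Icc hr hs Ψ).2 (dumbbellParams_mem_Icc hr hs Φ).2 h

theorem energy_lt_of_dumbbellParams_lt (hℓ : 1 ≤ ℓ) (hre : Even r) (hse : Even s)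
    (h : dumbbellParams hr hs Ψ < dumbbellParams hr hs Φ) : Φ.energy < Ψ.energy :=
  energy_lt_of_norm_det_lt fun t ht => by
    obtain ⟨F, hF, hdet⟩ := exists_norm_det_shiftMatrix_dumbbell hr hs hℓ hre hse ht
    rw [hdet, hdet]
    exact hF (dumbbellParams_mem_Icc hr hs Ψ).2 (dumbbellParams_mem_Icc hr hs Φ).2 h

end UnitGainGraph

end Dumbbell

section Existence

open SimpleGraph

theorem exists_circle_re_eq {x : ℝ} (hx : |x| ≤ 1) : ∃ z : Circle, (z : ℂ).re = x := by
  refine ⟨Circle.exp (Real.arccos x), ?_⟩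
  rw [Circle.coe_exp, Complex.exp_ofReal_mul_I_re,
    Real.cos_arccos (abs_le.1 hx).1 (abs_le.1 hx).2]

theorem finRotate_finRotate_ne {n : ℕ} (hn : 3 ≤ n) (i : Fin n) :
    finRotate n (finRotate n i) ≠ i := by
  obtain ⟨m, rfl⟩ : ∃ m, n = m + 3 := ⟨n - 3, by omega⟩
  rw [finRotate_apply, finRotate_apply, add_assoc, Ne, add_eq_left]
  exact nofun

namespace UnitGainGraph

variable {V : Type*} {G : SimpleGraph V}

/-- The product of gain graphs multiplies the gains of each oriented edge. -/
noncomputable instance : Mul (UnitGainGraph G) where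
  mul Φ Ψ := ⟨Φ.gain * Ψ.gain, fun d => by simp [Φ.gain_symm, Ψ.gain_symm, mul_comm]⟩

theorem mul_gain (Φ Ψ : UnitGainGraph G) : (Φ * Ψ).gain = Φ.gain * Ψ.gain := rfl

theorem cycleGain_mul (Φ Ψ : UnitGainGraph G) {n : ℕ} (hn : 3 ≤ n) (f : cycleGraph n →g G) :
    (Φ * Ψ).cycleGain hn f = Φ.cycleGain hn f * Ψ.cycleGain hn f := by
  simp only [cycleGain, mul_gain, Pi.mul_apply, Finset.prod_mul_distrib]

section OfDart

variable [DecidableEq V]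

/-- The gain graph with gain `z` on the oriented edge `e`, hence `z⁻¹` on its reverse, and gain `1`
on all other edges. -/
noncomputable def ofDart (e : G.Dart) (z : Circle) : UnitGainGraph G where
  gain := Pi.mulSingle e z * Pi.mulSingle e.symm z⁻¹
  gain_symm d := by
    have hne : e ≠ e.symm := e.symm_ne.symm
    simp only [Pi.mul_apply, Pi.mulSingle_apply, Dart.symm_involutive.eq_iff]
    split_ifs <;> simp_all

theorem cycleGain_ofDart {n : ℕ} (hn : 3 ≤ n) {f : cycleGraph n →g G}
    (hf : Function.Injective f) (i : Fin n) (z : Circle) :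
    (ofDart ⟨(f i, f (finRotate n i)), f.map_adj (cycleGraph_adj_finRotate hn i)⟩ z).cycleGain
      hn f = z := by
  have hne (j : Fin n) : ¬(j = finRotate n i ∧ finRotate n j = i) := by
    rintro ⟨rfl, hi⟩
    exact finRotate_finRotate_ne hn i hi
  simp only [cycleGain, ofDart, Pi.mul_apply, Pi.mulSingle_apply, Dart.ext_iff, Dart.symm,
    Prod.ext_iff, Prod.fst_swap, Prod.snd_swap, hf.eq_iff, (finRotate n).injective.eq_iff, hne,
    and_self, if_false, mul_one, Fintype.prod_ite_eq']

theorem cycleGain_ofDart_of_notMem_range {n : ℕ} (hn : 3 ≤ n) {f : cycleGraph n →g G}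
    {e : G.Dart} (he : e.fst ∉ Set.range f) (z : Circle) : (ofDart e z).cycleGain hn f = 1 := by
  have hne (j : Fin n) : f j ≠ e.fst := fun h => he ⟨j, h⟩
  simp [cycleGain, ofDart, Dart.ext_iff, Dart.symm, Prod.ext_iff, hne]

end OfDart

theorem exists_cycleGain_eq {m n : ℕ} (hm : 3 ≤ m) (hn : 3 ≤ n) {f : cycleGraph m →g G}
    {g : cycleGraph n →g G} (hf : Function.Injective f) (hg : Function.Injective g)
    (hfg : Disjoint (Set.range f) (Set.range g)) (z w : Circle) :
    ∃ Φ : UnitGainGraph G, Φ.cycleGain hm f = z ∧ Φ.cycleGain hn g = w := by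
  classical
  let i : Fin m := ⟨0, by omega⟩
  let j : Fin n := ⟨0, by omega⟩
  let d : G.Dart := ⟨(f i, f (finRotate m i)), f.map_adj (cycleGraph_adj_finRotate hm i)⟩
  let e : G.Dart := ⟨(g j, g (finRotate n j)), g.map_adj (cycleGraph_adj_finRotate hn j)⟩
  have hd : d.fst ∉ Set.range g := Set.disjoint_left.1 hfg ⟨i, rfl⟩
  have he : e.fst ∉ Set.range f := Set.disjoint_right.1 hfg ⟨j, rfl⟩
  refine ⟨ofDart d z * ofDart e w, ?_, ?_⟩
  · rw [cycleGain_mul, cycleGain_ofDart hm hf, cycleGain_ofDart_of_notMem_range hm he, mul_one]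
  · rw [cycleGain_mul, cycleGain_ofDart hn hg, cycleGain_ofDart_of_notMem_range hn hd, one_mul]

theorem exists_dumbbellParams_eq {r s : ℕ} (hr : 3 ≤ r) (hs : 3 ≤ s) (ℓ : ℕ) {p : ℝ × ℝ}
    (hp : p ∈ Set.Icc (-1) 1) :
    ∃ Φ : UnitGainGraph (dumbbellGraph r s ℓ), dumbbellParams hr hs Φ = p := by
  have hcircle (k : ℕ) {x : ℝ} (hx : -1 ≤ x ∧ x ≤ 1) :
      ∃ z : Circle, (-1) ^ k * (z : ℂ).re = x := by
    obtain ⟨z, hz⟩ := exists_circle_re_eq (x := (-1) ^ k * x)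
      (by rwa [abs_mul, abs_neg_one_pow, one_mul, abs_le])
    exact ⟨z, by rw [hz, ← mul_assoc, ← mul_pow, neg_mul_neg, one_mul, one_pow, one_mul]⟩
  obtain ⟨z, hz⟩ := hcircle (r / 2) ⟨hp.1.1, hp.2.1⟩
  obtain ⟨w, hw⟩ := hcircle (s / 2) ⟨hp.1.2, hp.2.2⟩
  obtain ⟨Φ, hΦz, hΦw⟩ := exists_cycleGain_eq hr hs (f := dumbbellCycleLeft r s ℓ)
    (g := dumbbellCycleRight r s ℓ) (dumbbellEmbeddingLeft r s ℓ).injective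
    (dumbbellEmbeddingRight r s ℓ).injective
    (Set.disjoint_range_iff.2 fun i j => Sum.inl_injective.ne Sum.inl_ne_inr) z w
  refine ⟨Φ, Prod.ext ?_ ?_⟩
  · rw [← hz, ← hΦz]
    rfl
  · rw [← hw, ← hΦw]
    rfl

end UnitGainGraph

end Existence

section Extremality

theorem forall_le_iff_eq_of_param_le {X A B : Type*} [PartialOrder A] [Preorder B] {p : X → A}
    {E : X → B} (hle : ∀ {x y}, p y ≤ p x → E x ≤ E y) (hlt : ∀ {x y}, p y < p x → E x < E y)
    {a : A} (ha : ∃ x, p x = a) (hmax : ∀ x, p x ≤ a) (x : X) :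
    (∀ y, E x ≤ E y) ↔ p x = a := by
  refine ⟨fun hx => ?_, fun hx y => hle ((hmax y).trans_eq hx.symm)⟩
  obtain ⟨x₀, rfl⟩ := ha
  by_contra hne
  exact (hlt ((hmax x).lt_of_ne hne)).not_ge (hx x₀)

theorem complex_re_eq_iff_of_abs_eq_norm {z : ℂ} {x : ℝ} (hx : |x| = ‖z‖) : z.re = x ↔ z = x := by
  refine ⟨fun h => Complex.ext h (Complex.abs_re_eq_norm.1 (by rw [h, hx])), fun h => ?_⟩
  rw [h, Complex.ofReal_re]

theorem circle_re_eq_one_iff {z : Circle} : (z : ℂ).re = 1 ↔ (z : ℂ) = 1 := by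
  simpa using complex_re_eq_iff_of_abs_eq_norm (z := z) (x := 1)
    (by rw [abs_one, Circle.norm_coe])

theorem circle_re_eq_neg_one_iff {z : Circle} : (z : ℂ).re = -1 ↔ (z : ℂ) = -1 := by
  simpa using complex_re_eq_iff_of_abs_eq_norm (z := z) (x := -1)
    (by rw [abs_neg, abs_one, Circle.norm_coe])

namespace UnitGainGraph

section CycleParam

variable {V : Type*} {G : SimpleGraph V} (Φ : UnitGainGraph G) {n : ℕ} (hn : 3 ≤ n)
  (f : SimpleGraph.cycleGraph n →g G)

theorem cycleParam_eq_iff_of_mod_four_eq_zero (h : n % 4 = 0) :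
    (Φ.cycleParam hn f = 1 ↔ (Φ.cycleGain hn f : ℂ) = 1) ∧
      (Φ.cycleParam hn f = -1 ↔ (Φ.cycleGain hn f : ℂ) = -1) := by
  have heven : Even (n / 2) := Nat.even_iff.2 (by omega)
  rw [cycleParam, heven.neg_one_pow, one_mul]
  exact ⟨circle_re_eq_one_iff, circle_re_eq_neg_one_iff⟩

theorem cycleParam_eq_iff_of_mod_four_eq_two (h : n % 4 = 2) :
    (Φ.cycleParam hn f = 1 ↔ (Φ.cycleGain hn f : ℂ) = -1) ∧
      (Φ.cycleParam hn f = -1 ↔ (Φ.cycleGain hn f : ℂ) = 1) := by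
  have hodd : Odd (n / 2) := Nat.odd_iff.2 (by omega)
  rw [cycleParam, hodd.neg_one_pow, neg_one_mul, neg_inj, neg_eq_iff_eq_neg]
  exact ⟨circle_re_eq_neg_one_iff, circle_re_eq_one_iff⟩

end CycleParam

variable {r s ℓ : ℕ} (hr : 3 ≤ r) (hs : 3 ≤ s)

theorem exists_dumbbellParams_eq_one (ℓ : ℕ) :
    ∃ Φ : UnitGainGraph (dumbbellGraph r s ℓ), dumbbellParams hr hs Φ = 1 :=
  exists_dumbbellParams_eq hr hs ℓ (Set.right_mem_Icc.2 (neg_le_self zero_le_one))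

theorem exists_dumbbellParams_eq_neg_one (ℓ : ℕ) :
    ∃ Φ : UnitGainGraph (dumbbellGraph r s ℓ), dumbbellParams hr hs Φ = -1 :=
  exists_dumbbellParams_eq hr hs ℓ (Set.left_mem_Icc.2 (neg_le_self zero_le_one))

variable {ℓ : ℕ} (Φ : UnitGainGraph (dumbbellGraph r s ℓ))

theorem isMinEnergy_iff_dumbbellParams_eq_one (hℓ : 1 ≤ ℓ) (hre : Even r) (hse : Even s) :
    IsMinEnergy Φ ↔ dumbbellParams hr hs Φ = 1 :=
  forall_le_iff_eq_of_param_le (energy_le_of_dumbbellParams_le hℓ hre hse)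
    (energy_lt_of_dumbbellParams_lt hℓ hre hse) (exists_dumbbellParams_eq_one hr hs ℓ)
    (fun Ψ => (dumbbellParams_mem_Icc hr hs Ψ).2) Φ

theorem isMaxEnergy_iff_dumbbellParams_eq_neg_one (hℓ : 1 ≤ ℓ) (hre : Even r) (hse : Even s) :
    IsMaxEnergy Φ ↔ dumbbellParams hr hs Φ = -1 :=
  forall_le_iff_eq_of_param_le (A := (ℝ × ℝ)ᵒᵈ) (B := ℝᵒᵈ)
    (energy_le_of_dumbbellParams_le hℓ hre hse) (energy_lt_of_dumbbellParams_lt hℓ hre hse)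
    (exists_dumbbellParams_eq_neg_one hr hs ℓ) (fun Ψ => (dumbbellParams_mem_Icc hr hs Ψ).1) Φ

theorem isMinEnergy_iff_and_isMaxEnergy_iff (hℓ : 1 ≤ ℓ) (hre : Even r) (hse : Even s)
    {P₁ P₂ Q₁ Q₂ : Prop}
    (hα : (alphaParam hr Φ = 1 ↔ P₁) ∧ (alphaParam hr Φ = -1 ↔ Q₁))
    (hβ : (betaParam hs Φ = 1 ↔ P₂) ∧ (betaParam hs Φ = -1 ↔ Q₂)) :
    (IsMinEnergy Φ ↔ P₁ ∧ P₂) ∧ (IsMaxEnergy Φ ↔ Q₁ ∧ Q₂) := by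
  rw [Φ.isMinEnergy_iff_dumbbellParams_eq_one hr hs hℓ hre hse,
    Φ.isMaxEnergy_iff_dumbbellParams_eq_neg_one hr hs hℓ hre hse]
  exact ⟨Prod.ext_iff.trans (and_congr hα.1 hβ.1), Prod.ext_iff.trans (and_congr hα.2 hβ.2)⟩

end UnitGainGraph

end Extremality

theorem mainTheorem2 (r s ℓ : ℕ) (hr : 3 ≤ r) (hs : 3 ≤ s) (hℓ : 1 ≤ ℓ)
    (hre : Even r) (hse : Even s) :
    -- the minimum and the maximum are attained, exactly at (1, 1) and (-1, -1) respectively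
    ((∃ Φ : UnitGainGraph (dumbbellGraph r s ℓ), IsMinEnergy Φ) ∧
      (∃ Φ : UnitGainGraph (dumbbellGraph r s ℓ), IsMaxEnergy Φ) ∧
      ∀ Φ : UnitGainGraph (dumbbellGraph r s ℓ),
        (IsMinEnergy Φ ↔ alphaParam hr Φ = 1 ∧ betaParam hs Φ = 1) ∧
        (IsMaxEnergy Φ ↔ alphaParam hr Φ = -1 ∧ betaParam hs Φ = -1)) ∧
    -- the extremal cycle gains according to the residues of r and s mod 4
    (r % 4 = 0 → s % 4 = 0 → ∀ Φ : UnitGainGraph (dumbbellGraph r s ℓ),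
        (IsMinEnergy Φ ↔ gammaLeft hr Φ = 1 ∧ gammaRight hs Φ = 1) ∧
        (IsMaxEnergy Φ ↔ gammaLeft hr Φ = -1 ∧ gammaRight hs Φ = -1)) ∧
    (r % 4 = 2 → s % 4 = 2 → ∀ Φ : UnitGainGraph (dumbbellGraph r s ℓ),
        (IsMinEnergy Φ ↔ gammaLeft hr Φ = -1 ∧ gammaRight hs Φ = -1) ∧
        (IsMaxEnergy Φ ↔ gammaLeft hr Φ = 1 ∧ gammaRight hs Φ = 1)) ∧
    (r % 4 = 0 → s % 4 = 2 → ∀ Φ : UnitGainGraph (dumbbellGraph r s ℓ),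
        (IsMinEnergy Φ ↔ gammaLeft hr Φ = 1 ∧ gammaRight hs Φ = -1) ∧
        (IsMaxEnergy Φ ↔ gammaLeft hr Φ = -1 ∧ gammaRight hs Φ = 1)) ∧
    (r % 4 = 2 → s % 4 = 0 → ∀ Φ : UnitGainGraph (dumbbellGraph r s ℓ),
        (IsMinEnergy Φ ↔ gammaLeft hr Φ = -1 ∧ gammaRight hs Φ = 1) ∧
        (IsMaxEnergy Φ ↔ gammaLeft hr Φ = 1 ∧ gammaRight hs Φ = -1)) := by
  obtain ⟨Φmin, hΦmin⟩ := UnitGainGraph.exists_dumbbellParams_eq_one hr hs ℓ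
  obtain ⟨Φmax, hΦmax⟩ := UnitGainGraph.exists_dumbbellParams_eq_neg_one hr hs ℓ
  have hmin : IsMinEnergy Φmin :=
    (Φmin.isMinEnergy_iff_dumbbellParams_eq_one hr hs hℓ hre hse).2 hΦmin
  have hmax : IsMaxEnergy Φmax :=
    (Φmax.isMaxEnergy_iff_dumbbellParams_eq_neg_one hr hs hℓ hre hse).2 hΦmax
  refine ⟨⟨⟨Φmin, hmin⟩, ⟨Φmax, hmax⟩, fun Φ => ?_⟩, fun h₁ h₂ Φ => ?_, fun h₁ h₂ Φ => ?_,
    fun h₁ h₂ Φ => ?_, fun h₁ h₂ Φ => ?_⟩ <;>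
    refine Φ.isMinEnergy_iff_and_isMaxEnergy_iff hr hs hℓ hre hse ?_ ?_
  · exact ⟨Iff.rfl, Iff.rfl⟩
  · exact ⟨Iff.rfl, Iff.rfl⟩
  · exact Φ.cycleParam_eq_iff_of_mod_four_eq_zero hr (dumbbellCycleLeft r s ℓ) h₁
  · exact Φ.cycleParam_eq_iff_of_mod_four_eq_zero hs (dumbbellCycleRight r s ℓ) h₂
  · exact Φ.cycleParam_eq_iff_of_mod_four_eq_two hr (dumbbellCycleLeft r s ℓ) h₁
  · exact Φ.cycleParam_eq_iff_of_mod_four_eq_two hs (dumbbellCycleRight r s ℓ) h₂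
  · exact Φ.cycleParam_eq_iff_of_mod_four_eq_zero hr (dumbbellCycleLeft r s ℓ) h₁
  · exact Φ.cycleParam_eq_iff_of_mod_four_eq_two hs (dumbbellCycleRight r s ℓ) h₂
  · exact Φ.cycleParam_eq_iff_of_mod_four_eq_two hr (dumbbellCycleLeft r s ℓ) h₁
  · exact Φ.cycleParam_eq_iff_of_mod_four_eq_zero hs (dumbbellCycleRight r s ℓ) h₂
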